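/- Notation. Write $\mathbf t=(t_1,t_2,\dots)$, $\xi(\mathbf t,z)=\sum_{k\ge1}t_kz^k$, $[w]=(w,w^2/2,w^3/3,\dots)$, $\mathrm{Res}_z\sum_i a_iz^i=a_{-1}$, and let $\Lambda$ be the shift $\Lambda(f)(n)=f(n+1)$, $\Delta=\Lambda-1$, $\big(\sum_jf_j(n)\Lambda^j\big)^*=\sum_j\Lambda^{-j}f_j(n)$. Functions of the times are formal power series over $\mathbb C$. A large BKP tau function is a sequence $\tau_n(\mathbf t)\neq0$ $(n\in\mathbb Z)$ such that for all $n',n''\in\mathbb Z$ $$\mathrm{Res}_z\Big(z^{n'-n''-2}\tau_{n'-1}(\mathbf t'-[z^{-1}])\tau_{n''+1}(\mathbf t''+[z^{-1}])e^{\xi(\mathbf t'-\mathbf t'',z)}+z^{n''-n'-2}\tau_{n'+1}(\mathbf t'+[z^{-1}])\tau_{n''-1}(\mathbf t''-[z^{-1}])e^{-\xi(\mathbf t'-\mathbf t'',z)}\Big)=\tfrac12\big(1-(-1)^{n'+n''}\big)\tau_{n'}(\mathbf t')\tau_{n''}(\mathbf t'').$$ Its wave operators $S^+=\sum_{j\ge0}b_j(n,\mathbf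 t)\Lambda^{-j}$ and $S^-=\sum_{j\ge0}\Lambda^{-j}\bar b_j(n,\mathbf t)$ are defined by $$S^+e^{\xi(\mathbf t,\Lambda)}(z^n)=\frac{\tau_{n-1}(\mathbf t-[z^{-1}])}{\tau_n(\mathbf t)}e^{\xi(\mathbf t,z)}z^n,\qquad (S^-)^*e^{-\xi(\mathbf t,\Lambda^{-1})}(z^{-n-1})=\frac{\tau_{n+1}(\mathbf t+[z^{-1}])}{\tau_n(\mathbf t)}e^{-\xi(\mathbf t,z)}z^{-n-1}.$$ A Toda tau function is a sequence $\tau^{\rm Toda}_n(x,y)\ne0$ $(n\in\mathbb Z)$ such that for all $n,n'\in\mathbb Z$ $$\oint_{z=\infty}\frac{dz}{2\pi iz}z^{n-n'}\tau^{\rm Toda}_n(x-[z^{-1}],y)\,\tau^{\rm Toda}_{n'+1}(x'+[z^{-1}],y')e^{\xi(x-x',z)}=\oint_{z=0}\frac{dz}{2\pi iz}z^{n-n'}\tau^{\rm Toda}_{n+1}(x,y-[z])\,\tau^{\rm Toda}_{n'}(x',y'+[z])e^{\xi(y-y',z^{-1})}.$$ It is said to be derived from $\tau_n$ by the Miura transformation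 $T_1=b_0(n)^{-1}$, respectively $T_2=b_0(n+1)^{-1}\Delta$, if $\tau^{\rm Toda}_n(\mathbf t,-\mathbf t)\neq0$ for all $n$ and if at $(x,y)=(\mathbf t,-\mathbf t)$ $$\mathcal S_1e^{\xi(x,\Lambda)}(z^n)=\frac{\tau^{\rm Toda}_n(x-[z^{-1}],y)}{\tau^{\rm Toda}_n(x,y)}e^{\xi(x,z)}z^n,\qquad \mathcal S_2e^{\xi(y,\Lambda^{-1})}(z^n)=\frac{\tau^{\rm Toda}_{n+1}(x,y-[z])}{\tau^{\rm Toda}_n(x,y)}e^{\xi(y,z^{-1})}z^n,$$ where $\mathcal S_1=T_1S^+$, $\mathcal S_2=T_1(S^-)^*$ for $T_1$, and $\mathcal S_1=T_2S^+\Lambda^{-1}$, $\mathcal S_2=-T_2(S^-)^*$ for $T_2$. Theorem. Let $\tau_n(\mathbf t)$ be a large BKP tau function, and let $\tau^{\rm Toda}_n(x,y)$ be a Toda tau function derived from it by the Miura transformation $T_i$. Then there is a non-zero constant $\mathrm{const}\in\mathbb C$, independent of $n$ and $\mathbf t$, such that for all $n\in\mathbb Z$ $$\tau^{\rm Toda}_n(\mathbf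 t,-\mathbf t)=\begin{cases}\mathrm{const}\cdot\tau_n(\mathbf t)\,\tau_{n-1}(\mathbf t)&\text{for }T_1,\\ \mathrm{const}\cdot\tau_n(\mathbf t)^2&\text{for }T_2.\end{cases}$$ -/

import Mathlib

namespace LargeBKP

/-! ### Formal functions of the time variables

Functions of infinitely many times are formal power series over `ℂ`; the variable with index
`k : ℕ+` is the `k`-th time. -/

/-- Formal functions `f(𝐭)` of the times `𝐭 = (t₁, t₂, …)`. -/
abbrev OneTime : Type := MvPowerSeries ℕ+ ℂ

/-- Formal functions `F(x, y)` of two sequences of times; `Sum.inl k` is `x_k` and `Sum.inr k`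
is `y_k`. -/
abbrev TwoTime : Type := MvPowerSeries (ℕ+ ⊕ ℕ+) ℂ

/-- The field of fractions of the formal functions of `𝐭`. -/
abbrev TimeField : Type := FractionRing OneTime

/-- The substitution that sends the `k`-th variable of `ι` to `v i + ε(i) w ^ {k(i)} / k(i)`, with
`w` (the variable `none`) the local spectral parameter.  Here `v` renames the variables, `k` is
the number of a time inside its sequence and `ε` selects the shifted variables and the sign of
the shift. -/
noncomputable def miwaSubst {ι σ : Type} (v : ι → σ) (k : ι → ℕ+) (ε : ι → ℂ) :
    ι → MvPowerSeries (Option σ) ℂ :=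
  fun i => MvPowerSeries.X (some (v i)) +
    MvPowerSeries.C (ε i / ((k i : ℕ) : ℂ)) * MvPowerSeries.X none ^ (k i : ℕ)

/-- The result of that substitution, expanded in powers of `w`. -/
noncomputable def miwa {ι σ : Type} (v : ι → σ) (k : ι → ℕ+) (ε : ι → ℂ)
    (f : MvPowerSeries ι ℂ) : PowerSeries (MvPowerSeries σ ℂ) :=
  MvPowerSeries.optionEquivLeft σ ℂ (MvPowerSeries.subst (miwaSubst v k ε) f)

/-- The substitution is legitimate (so that `miwa` has its intended value) as soon as no two
variables of the same kind are identified. -/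
theorem hasSubst_miwaSubst {ι σ : Type} (v : ι → σ) (hv : Function.Injective v) (k : ι → ℕ+)
    (hk : ∀ m, {i | k i = m}.Finite) (ε : ι → ℂ) :
    MvPowerSeries.HasSubst (miwaSubst v k ε) where
  const_coeff i := by
    have h : ((k i : ℕ+) : ℕ) ≠ 0 := (k i).ne_zero
    simp [miwaSubst, h]
  coeff_zero d := by
    classical
    have h1 : {i | d = Finsupp.single (some (v i)) 1}.Finite := by
      apply Set.Subsingleton.finite
      intro i hi j hj
      have hi' : d = Finsupp.single (some (v i)) 1 := hi
      have hj' : d = Finsupp.single (some (v j)) 1 := hj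
      have h := hi'.symm.trans hj'
      have := (Finsupp.single_left_injective (one_ne_zero : (1 : ℕ) ≠ 0)) h
      exact hv (Option.some_injective _ this)
    have h2 : {i | d = Finsupp.single none (k i : ℕ)}.Finite := by
      by_cases hd : ∃ m : ℕ+, d = Finsupp.single none (m : ℕ)
      · obtain ⟨m, rfl⟩ := hd
        refine (hk m).subset ?_
        intro i hi
        have := Finsupp.single_injective none hi
        exact (PNat.coe_injective this).symm
      · convert Set.finite_empty
        ext i
        simp only [Set.mem_ofPred_eq, Set.mem_empty_iff_false, iff_false]
        exact fun h => hd ⟨_, h⟩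
    refine (h1.union h2).subset ?_
    intro i hi
    by_contra hcon
    simp only [Set.mem_union, Set.mem_ofPred_eq, not_or] at hcon
    apply hi
    rw [miwaSubst, map_add, MvPowerSeries.coeff_C_mul, MvPowerSeries.coeff_X,
      MvPowerSeries.coeff_X_pow, if_neg hcon.1, if_neg hcon.2, mul_zero, add_zero]

/-- `f(𝐭 + ε[w])`, where `[w] = (w, w²/2, w³/3, …)`, as a power series in `w`. -/
noncomputable def shiftT (ε : ℂ) (f : OneTime) : PowerSeries OneTime :=
  miwa id id (fun _ => ε) f

/-- `F(x + ε[w], y)` as a power series in `w`. -/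
noncomputable def shiftX (ε : ℂ) (F : TwoTime) : PowerSeries TwoTime :=
  miwa id (Sum.elim id id) (Sum.elim (fun _ => ε) (fun _ => 0)) F

/-- `F(x, y + ε[w])` as a power series in `w`. -/
noncomputable def shiftY (ε : ℂ) (F : TwoTime) : PowerSeries TwoTime :=
  miwa id (Sum.elim id id) (Sum.elim (fun _ => 0) (fun _ => ε)) F

/-- The restriction `F(𝐭, -𝐭)` of `F(x, y)` to the slice `x = 𝐭`, `y = -𝐭`. -/
noncomputable def slice (F : TwoTime) : OneTime :=
  MvPowerSeries.subst
    (Sum.elim (fun k => MvPowerSeries.X k) (fun k => -MvPowerSeries.X k) : ℕ+ ⊕ ℕ+ → OneTime) F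

/-- The substitution in `slice` is legitimate. -/
theorem hasSubst_slice : MvPowerSeries.HasSubst
    (Sum.elim (fun k => MvPowerSeries.X k) (fun k => -MvPowerSeries.X k) :
      ℕ+ ⊕ ℕ+ → OneTime) where
  const_coeff i := by rcases i with i | i <;> simp
  coeff_zero d := by
    classical
    have h1 : {i : ℕ+ | d = Finsupp.single i 1}.Finite := by
      apply Set.Subsingleton.finite
      intro i hi j hj
      have hi' : d = Finsupp.single i 1 := hi
      have hj' : d = Finsupp.single j 1 := hj
      exact (Finsupp.single_left_injective (one_ne_zero : (1 : ℕ) ≠ 0)) (hi'.symm.trans hj')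
    refine ((h1.image Sum.inl).union (h1.image Sum.inr)).subset ?_
    rintro (i | i) hi
    · left
      refine ⟨i, ?_, rfl⟩
      by_contra hcon
      exact hi (by simp [MvPowerSeries.coeff_X, show ¬ d = Finsupp.single i 1 from hcon])
    · right
      refine ⟨i, ?_, rfl⟩
      by_contra hcon
      exact hi (by simp [MvPowerSeries.coeff_X, show ¬ d = Finsupp.single i 1 from hcon])

/-! ### Residues and the two bilinear equations -/

/-- `exp (∑_{k ≥ 1} u_k z ^ k)` as a power series in `z`; for `u = 𝐭' - 𝐭''` this is
`e^{ξ(𝐭' - 𝐭'', z)}`. -/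
noncomputable def expXi {σ : Type} (u : ℕ+ → MvPowerSeries σ ℂ) :
    PowerSeries (MvPowerSeries σ ℂ) :=
  (PowerSeries.exp ℂ).subst
    (PowerSeries.mk fun k => if h : 0 < k then u ⟨k, h⟩ else 0 : PowerSeries (MvPowerSeries σ ℂ))

/-- The coefficient of `w ^ j`, with `j` an integer (it is `0` for `j < 0`). -/
noncomputable def zcoeff {R : Type} [CommRing R] (P : PowerSeries R) (j : ℤ) : R :=
  if 0 ≤ j then PowerSeries.coeff j.toNat P else 0

/-- The coefficient of `z ^ s` in `h(z) P(z⁻¹)`, namely `∑_{k ≥ 0} h_k P_{k - s}`.  When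
`h = e^{ξ(𝐭' - 𝐭'', z)}`, the series `h_k` is weighted homogeneous of weight `k`, so that each
coefficient of this sum receives only finitely many non-zero contributions; the sum is taken
coefficientwise. -/
noncomputable def mixedCoeff {σ : Type} (h P : PowerSeries (MvPowerSeries σ ℂ)) (s : ℤ) :
    MvPowerSeries σ ℂ :=
  fun d => ∑ᶠ k : ℕ, MvPowerSeries.coeff d (PowerSeries.coeff k h * zcoeff P ((k : ℤ) - s))

/-- `Res_z z ^ N h(z) P(z⁻¹)`, with `Res_z ∑ a_i z ^ i = a_{-1}`. -/
noncomputable def res {σ : Type} (N : ℤ) (h P : PowerSeries (MvPowerSeries σ ℂ)) :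
    MvPowerSeries σ ℂ :=
  mixedCoeff h P (-1 - N)

/-- `f(𝐭' + ε[w])` inside the functions of `(𝐭', 𝐭'')`. -/
noncomputable def shiftT₁ (ε : ℂ) (f : OneTime) : PowerSeries TwoTime :=
  miwa Sum.inl id (fun _ => ε) f

/-- `f(𝐭'' + ε[w])` inside the functions of `(𝐭', 𝐭'')`. -/
noncomputable def shiftT₂ (ε : ℂ) (f : OneTime) : PowerSeries TwoTime :=
  miwa Sum.inr id (fun _ => ε) f

/-- A tau function of the large BKP hierarchy: a sequence `(τ_n)_{n ∈ ℤ}` of non-zero formal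
functions of `𝐭` satisfying, for all integers `n'`, `n''`,
`Res_z ( z^{n'-n''-2} τ_{n'-1}(𝐭'-[z⁻¹]) τ_{n''+1}(𝐭''+[z⁻¹]) e^{ξ(𝐭'-𝐭'',z)}`
`      + z^{n''-n'-2} τ_{n'+1}(𝐭'+[z⁻¹]) τ_{n''-1}(𝐭''-[z⁻¹]) e^{-ξ(𝐭'-𝐭'',z)} )`
`= (1 - (-1)^{n'+n''}) / 2 · τ_{n'}(𝐭') τ_{n''}(𝐭'')`. -/
structure IsLargeBKPTau (τ : ℤ → OneTime) : Prop where
  ne_zero : ∀ n, τ n ≠ 0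
  bilinear : ∀ n' n'' : ℤ,
    res (n' - n'' - 2)
        (expXi fun k => (MvPowerSeries.X (Sum.inl k) - MvPowerSeries.X (Sum.inr k) : TwoTime))
        (shiftT₁ (-1) (τ (n' - 1)) * shiftT₂ 1 (τ (n'' + 1))) +
      res (n'' - n' - 2)
        (expXi fun k => (MvPowerSeries.X (Sum.inr k) - MvPowerSeries.X (Sum.inl k) : TwoTime))
        (shiftT₁ 1 (τ (n' + 1)) * shiftT₂ (-1) (τ (n'' - 1))) =
    MvPowerSeries.C ((1 - (-1 : ℂ) ^ (n' + n'')) / 2) *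
      (MvPowerSeries.subst (fun k => (MvPowerSeries.X (Sum.inl k) : TwoTime)) (τ n') *
        MvPowerSeries.subst (fun k => (MvPowerSeries.X (Sum.inr k) : TwoTime)) (τ n''))

/-- Formal functions of `(x, y, x', y')`; `Sum.inl` stands for `(x, y)` and `Sum.inr` for
`(x', y')`. -/
abbrev FourTime : Type := MvPowerSeries ((ℕ+ ⊕ ℕ+) ⊕ (ℕ+ ⊕ ℕ+)) ℂ

/-- `F(x + ε[w], y + δ[w])` inside the functions of `(x, y, x', y')`. -/
noncomputable def shiftXY₁ (ε δ : ℂ) (F : TwoTime) : PowerSeries FourTime :=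
  miwa Sum.inl (Sum.elim id id) (Sum.elim (fun _ => ε) (fun _ => δ)) F

/-- `F(x' + ε[w], y' + δ[w])` inside the functions of `(x, y, x', y')`. -/
noncomputable def shiftXY₂ (ε δ : ℂ) (F : TwoTime) : PowerSeries FourTime :=
  miwa Sum.inr (Sum.elim id id) (Sum.elim (fun _ => ε) (fun _ => δ)) F

/-- A tau function of the (two-dimensional) Toda hierarchy: a sequence `(F_n)_{n ∈ ℤ}` of non-zero
formal functions of `(x, y)` satisfying, for all integers `n`, `n'`,
`∮_{z=∞} dz/(2πiz) z^{n-n'} F_n(x-[z⁻¹],y) F_{n'+1}(x'+[z⁻¹],y') e^{ξ(x-x',z)}`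
`= ∮_{z=0} dz/(2πiz) z^{n-n'} F_{n+1}(x,y-[z]) F_{n'}(x',y'+[z]) e^{ξ(y-y',z⁻¹)}`.
Both sides are coefficients of `z ^ 0`; on the right-hand side the formula below is written in
the variable `z⁻¹`. -/
structure IsTodaTau (F : ℤ → TwoTime) : Prop where
  ne_zero : ∀ n, F n ≠ 0
  bilinear : ∀ n n' : ℤ,
    res (n - n' - 1)
        (expXi fun k => (MvPowerSeries.X (Sum.inl (Sum.inl k)) -
          MvPowerSeries.X (Sum.inr (Sum.inl k)) : FourTime))
        (shiftXY₁ (-1) 0 (F n) * shiftXY₂ 1 0 (F (n' + 1))) =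
      res (n' - n - 1)
        (expXi fun k => (MvPowerSeries.X (Sum.inl (Sum.inr k)) -
          MvPowerSeries.X (Sum.inr (Sum.inr k)) : FourTime))
        (shiftXY₁ 0 (-1) (F (n + 1)) * shiftXY₂ 0 1 (F n'))

/-! ### Pseudo-difference operators and wave functions -/

/-- A formal pseudo-difference operator `∑_j a_j(n) Λ ^ j` in the shift `Λ : n ↦ n + 1`, given by
its coefficients `A j n = a_j(n)`. -/
abbrev DiffOp : Type := ℤ → ℤ → TimeField

namespace DiffOp

/-- The product, determined by `(a Λ^i) (b Λ^j) = a(n) b(n + i) Λ^(i+j)`.  It is used only where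
each of the sums is finite. -/
noncomputable def comp (A B : DiffOp) : DiffOp :=
  fun m n => ∑ᶠ i : ℤ, A i n * B (m - i) (n + i)

/-- The adjoint `(∑_j f_j(n) Λ^j)^* = ∑_j Λ^(-j) f_j(n)`. -/
def adjoint (A : DiffOp) : DiffOp := fun m n => A (-m) (n + m)

/-- Multiplication by the function `f(n)`. -/
noncomputable def mulBy (f : ℤ → TimeField) : DiffOp := fun j n => if j = 0 then f n else 0

/-- The power `Λ ^ k` of the shift. -/
noncomputable def shift (k : ℤ) : DiffOp := fun j _ => if j = k then 1 else 0

/-- The difference operator `Δ = Λ - 1`. -/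
noncomputable def delta : DiffOp := shift 1 - shift 0

/-- The action on functions of `n` and of the spectral parameter `z`.  Such a function is a
formal series `∑_m f(n)_m z ^ m`, recorded as `f n m = f(n)_m`. -/
noncomputable def act (A : DiffOp) (f : ℤ → ℤ → TimeField) : ℤ → ℤ → TimeField :=
  fun n m => ∑ᶠ j : ℤ, A j n * f (n + j) m

end DiffOp

/-- The function `z ^ n` of `n` and `z`. -/
noncomputable def zPow : ℤ → ℤ → TimeField := fun n m => if m = n then 1 else 0

/-- The function `z ^ (-n-1)` of `n` and `z`. -/
noncomputable def zPowNeg : ℤ → ℤ → TimeField := fun n m => if m = -n - 1 then 1 else 0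

/-! All wave functions below are recorded without their exponential factors.  These do not depend
on `n`, so they commute with all difference operators, and
`e^{ξ(𝐭,Λ)}(z^n) = e^{ξ(𝐭,z)} z^n`, `e^{ξ(𝐭,Λ⁻¹)}(z^n) = e^{ξ(𝐭,z⁻¹)} z^n`,
`e^{-ξ(𝐭,Λ⁻¹)}(z^{-n-1}) = e^{-ξ(𝐭,z)} z^{-n-1}`. -/

/-- `Ψ⁺(n,𝐭,z) = τ_{n-1}(𝐭-[z⁻¹]) / τ_n(𝐭) · z^n e^{ξ(𝐭,z)}`, without the factor
`e^{ξ(𝐭,z)}`. -/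
noncomputable def psiPlus (τ : ℤ → OneTime) : ℤ → ℤ → TimeField :=
  fun n m => algebraMap OneTime TimeField (zcoeff (shiftT (-1) (τ (n - 1))) (n - m)) /
    algebraMap OneTime TimeField (τ n)

/-- `Ψ⁻(n,𝐭,z) = τ_{n+1}(𝐭+[z⁻¹]) / τ_n(𝐭) · z^{-n-1} e^{-ξ(𝐭,z)}`, without the factor
`e^{-ξ(𝐭,z)}`. -/
noncomputable def psiMinus (τ : ℤ → OneTime) : ℤ → ℤ → TimeField :=
  fun n m => algebraMap OneTime TimeField (zcoeff (shiftT 1 (τ (n + 1))) (-n - 1 - m)) /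
    algebraMap OneTime TimeField (τ n)

/-- `S⁺ = ∑_{j ≥ 0} b_j(n,𝐭) Λ^{-j}` and `S⁻ = ∑_{j ≥ 0} Λ^{-j} b̄_j(n,𝐭)` are the wave operators
of the large BKP tau function `τ`: with `W⁺ = S⁺ e^{ξ(𝐭,Λ)}` and `W⁻ = e^{-ξ(𝐭,Λ)} S⁻`, one has
`Ψ⁺ = W⁺(z^n)` and `Ψ⁻ = (W⁻)^*(z^{-n-1})`. -/
structure IsWaveOperators (τ : ℤ → OneTime) (Sp Sm : DiffOp) : Prop where
  plus_support : ∀ j, 0 < j → ∀ n, Sp j n = 0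
  minus_support : ∀ j, 0 < j → ∀ n, Sm j n = 0
  plus_act : Sp.act zPow = psiPlus τ
  minus_act : Sm.adjoint.act zPowNeg = psiMinus τ

/-! ### The Miura transformations -/

/-- `b_0(n)`, the coefficient of `Λ^0` in `S⁺`. -/
def b₀ (Sp : DiffOp) (n : ℤ) : TimeField := Sp 0 n

/-- The Miura transformation `T₁ = b_0(n)⁻¹`. -/
noncomputable def T₁ (Sp : DiffOp) : DiffOp := DiffOp.mulBy fun n => (b₀ Sp n)⁻¹

/-- The Miura transformation `T₂ = b_0(n+1)⁻¹ Δ`. -/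
noncomputable def T₂ (Sp : DiffOp) : DiffOp :=
  (DiffOp.mulBy fun n => (b₀ Sp (n + 1))⁻¹).comp DiffOp.delta

/-- The pair of Toda wave operators `(𝒮₁, 𝒮₂)` at `(x, y) = (𝐭, -𝐭)` produced by `T₁`:
`𝒮₁ = T₁ S⁺`, `𝒮₂ = T₁ (S⁻)^*`. -/
noncomputable def miura₁ (Sp Sm : DiffOp) : DiffOp × DiffOp :=
  ((T₁ Sp).comp Sp, (T₁ Sp).comp Sm.adjoint)

/-- The pair of Toda wave operators `(𝒮₁, 𝒮₂)` at `(x, y) = (𝐭, -𝐭)` produced by `T₂`: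
`𝒮₁ = T₂ S⁺ Λ⁻¹`, `𝒮₂ = -T₂ (S⁻)^*`. -/
noncomputable def miura₂ (Sp Sm : DiffOp) : DiffOp × DiffOp :=
  (((T₂ Sp).comp Sp).comp (DiffOp.shift (-1)), -((T₂ Sp).comp Sm.adjoint))

/-- The Toda wave function
`Ψ₁(n,x,y,z) = F_n(x-[z⁻¹],y) / F_n(x,y) · z^n e^{ξ(x,z)}` of the Toda tau function `F`, at
`(x, y) = (𝐭, -𝐭)` and without the factor `e^{ξ(𝐭,z)}`. -/
noncomputable def todaPsi₁ (F : ℤ → TwoTime) : ℤ → ℤ → TimeField :=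
  fun n m => algebraMap OneTime TimeField (slice (zcoeff (shiftX (-1) (F n)) (n - m))) /
    algebraMap OneTime TimeField (slice (F n))

/-- The Toda wave function
`Ψ₂(n,x,y,z) = F_{n+1}(x,y-[z]) / F_n(x,y) · z^n e^{ξ(y,z⁻¹)}` of the Toda tau function `F`, at
`(x, y) = (𝐭, -𝐭)` and without the factor `e^{-ξ(𝐭,z⁻¹)}`. -/
noncomputable def todaPsi₂ (F : ℤ → TwoTime) : ℤ → ℤ → TimeField :=
  fun n m => algebraMap OneTime TimeField (slice (zcoeff (shiftY (-1) (F (n + 1))) (m - n))) /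
    algebraMap OneTime TimeField (slice (F n))

/-- `F` is a Toda tau function belonging to the Toda wave operators `𝒮 = (𝒮₁, 𝒮₂)` given at
`(x, y) = (𝐭, -𝐭)`: it is a Toda tau function, its restriction to this slice is non-zero, and
its wave functions are there `Ψ₁ = 𝒮₁ e^{ξ(x,Λ)}(z^n)` and `Ψ₂ = 𝒮₂ e^{ξ(y,Λ⁻¹)}(z^n)`. -/
structure IsTodaTauOf (F : ℤ → TwoTime) (S : DiffOp × DiffOp) : Prop where
  isTodaTau : IsTodaTau F
  slice_ne_zero : ∀ n, slice (F n) ≠ 0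
  psi₁ : todaPsi₁ F = S.1.act zPow
  psi₂ : todaPsi₂ F = S.2.act zPow

end LargeBKP

/-!
The whole argument takes place on the slice `(x, y) = (𝐭, -𝐭)` and uses the two wave functions of the
Toda tau function `F_n` only.  Put `G_n(𝐭) = F_n(𝐭, -𝐭)`.  The wave operators are known explicitly:
the coefficients of `S⁺` and `(S⁻)^*` are those of `τ_{n-1}(𝐭-[w]) / τ_n(𝐭)` and
`τ_{n+1}(𝐭+[w]) / τ_n(𝐭)`, so that `b_0(n) = τ_{n-1} / τ_n`.

For `T₁` the equations for the wave functions read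
`F_n(𝐭-[w], -𝐭) / G_n(𝐭) = τ_{n-1}(𝐭-[w]) / τ_{n-1}(𝐭)` and
`F_{n+1}(𝐭, -𝐭-[w]) / G_n(𝐭) = τ_{n+1}(𝐭+[w]) / τ_{n-1}(𝐭)`.
The second one at `w = 0` says that `c(𝐭) = G_n / (τ_n τ_{n-1})` does not depend on `n`, and then
`F_n(𝐭-[w], -𝐭) = c(𝐭) τ_n(𝐭) τ_{n-1}(𝐭-[w])` and `F_n(𝐬, -𝐬-[w]) = c(𝐬) τ_{n-1}(𝐬) τ_n(𝐬+[w])`.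
The key observation is that for `𝐬 = 𝐭 - [w]` the left-hand sides are the same value of `F_n`
(`translate_sliceShift`), and so are the two products of tau functions.  Hence `c(𝐭) = c(𝐭-[w])`.
For `T₂` one finds in the same way `c(𝐭) = G_n / τ_n²` independent of `n`, and
`F_n(𝐭-[w], -𝐭) = c(𝐭) (τ_n(𝐭) τ_n(𝐭-[w]) - w τ_{n+1}(𝐭) τ_{n-1}(𝐭-[w]))`,
`F_n(𝐬, -𝐬-[w]) = c(𝐬) (τ_n(𝐬) τ_n(𝐬+[w]) - w τ_{n-1}(𝐬) τ_{n+1}(𝐬+[w]))`,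
whose brackets again agree for `𝐬 = 𝐭 - [w]`.  This common step is
`exists_eq_C_mul_of_sliceShift`.

It remains to see that a quotient `f / g` that is invariant under `𝐭 ↦ 𝐭 - [w]` is a constant
(`exists_eq_C_mul_of_shiftHom`).  The derivation `w ∂_w + ∑_k w ^ k ∂_k` annihilates every
`f(𝐭-[w])`; applied to `f(𝐭) g(𝐭-[w]) = f(𝐭-[w]) g(𝐭)` it gives `g ∂_k f = f ∂_k g` for all `k`.
Comparing lexicographically leading terms, this forces `f` and `g` to be proportional
(`exists_eq_C_mul_of_mul_pderiv_eq`).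
-/

namespace LargeBKP

open MvPowerSeries

/-! ### Substitution into power series with a distinguished variable -/

section General

variable {σ τ R : Type} [CommRing R]

open scoped MvPowerSeries.WithPiTopology in
/-- Algebra maps that are continuous for the product topology over the discrete coefficient ring
commute with substitution. -/
theorem algHom_subst_of_continuous {υ : Type} {a : σ → MvPowerSeries τ R} (ha : HasSubst a)
    (ε : MvPowerSeries τ R →ₐ[R] MvPowerSeries υ R)
    (hε : ∀ [UniformSpace R] [DiscreteUniformity R], Continuous ε) (f : MvPowerSeries σ R) :
    ε (subst a f) = subst (fun i => ε (a i)) f := by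
  let : UniformSpace R := ⊥
  have h := comp_subst_apply ha hε f
  have hs : HasSubst (fun i => ε (a i)) :=
    hasSubst_iff_hasEval_of_discreteTopology.mpr (ha.hasEval.map hε)
  rw [h, ← coe_substAlgHom hs, substAlgHom_eq_aeval hs]

open scoped MvPowerSeries.WithPiTopology in
theorem constantCoeff_optionEquivLeft_subst {a : σ → MvPowerSeries (Option τ) R} (ha : HasSubst a)
    (f : MvPowerSeries σ R) :
    PowerSeries.constantCoeff (optionEquivLeft τ R (subst a f)) =
      subst (fun i => PowerSeries.constantCoeff (optionEquivLeft τ R (a i))) f := by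
  let c : PowerSeries (MvPowerSeries τ R) →ₐ[R] MvPowerSeries τ R :=
    { PowerSeries.constantCoeff (R := MvPowerSeries τ R) with
      commutes' := fun r => by
        change PowerSeries.constantCoeff (algebraMap R _ r) = _
        rw [IsScalarTower.algebraMap_apply R (MvPowerSeries τ R)]
        simp }
  exact algHom_subst_of_continuous ha (c.comp (optionEquivLeft τ R).toAlgHom) (by
    intro _ _
    refine continuous_pi fun x => ?_
    refine (WithPiTopology.continuous_coeff R (x.optionElim 0)).congr fun p => ?_
    rw [← coeff_coeff_optionEquivLeft, PowerSeries.coeff_zero_eq_constantCoeff_apply]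
    rfl) f

theorem hasSubst_option {b : Option σ → MvPowerSeries τ R} (h : HasSubst fun i => b (some i))
    (h0 : constantCoeff (b none) = 0) : HasSubst b where
  const_coeff i := by
    cases i with
    | none => rw [h0]; exact IsNilpotent.zero
    | some i => exact h.const_coeff i
  coeff_zero d := by
    refine (((h.coeff_zero d).image some).union (Set.finite_singleton none)).subset ?_
    rintro (_ | i) hi
    · exact Or.inr rfl
    · exact Or.inl ⟨i, hi, rfl⟩

theorem optionEquivLeft_rename_some (f : MvPowerSeries σ R) :
    optionEquivLeft σ R (rename Function.Embedding.some f) = PowerSeries.C f := by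
  classical
  ext n x
  rw [coeff_coeff_optionEquivLeft, PowerSeries.coeff_C]
  split_ifs with hn
  · subst hn
    have hx : x.optionElim 0 = Finsupp.embDomain Function.Embedding.some x := by
      ext (_ | i)
      · rw [Finsupp.optionElim_apply_none, Finsupp.embDomain_of_notMem_range _ _ _ (by simp)]
      · rw [Finsupp.optionElim_apply_some]
        exact (Finsupp.embDomain_apply_self Function.Embedding.some x i).symm
    rw [hx, coeff_embDomain_rename]
  · rw [map_zero, coeff_rename_eq_zero]
    rintro ⟨y, hy⟩
    have h := DFunLike.congr_fun hy none
    rw [Finsupp.optionElim_apply_none, Finsupp.mapDomain_of_notMem_range _ _ (by simp)] at h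
    exact hn h.symm

/-- The extension of the substitution `b` to series in one more variable `none`, which is kept. -/
noncomputable def extendSubst (b : σ → MvPowerSeries τ R) : Option σ → MvPowerSeries (Option τ) R
  | none => X none
  | some i => rename Function.Embedding.some (b i)

theorem hasSubst_extendSubst {b : σ → MvPowerSeries τ R} (hb : HasSubst b) :
    HasSubst (extendSubst b) := by
  refine hasSubst_option ?_ (constantCoeff_X none)
  have h := hb.comp (HasSubst.X_comp (R := R) (f := (Function.Embedding.some : τ ↪ Option τ)))
  convert h using 2 with i
  rw [coe_substAlgHom, ← rename_eq_subst]
  rfl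

open scoped MvPowerSeries.WithPiTopology in
/-- Substituting for the variables other than `none` acts on each coefficient of the expansion in
powers of `none`. -/
theorem optionEquivLeft_subst_extendSubst {b : σ → MvPowerSeries τ R} (hb : HasSubst b)
    (p : MvPowerSeries (Option σ) R) :
    optionEquivLeft τ R (subst (extendSubst b) p) =
      PowerSeries.map (substAlgHom (R := R) hb).toRingHom (optionEquivLeft σ R p) := by
  let m : PowerSeries (MvPowerSeries σ R) →ₐ[R] PowerSeries (MvPowerSeries τ R) :=
    { PowerSeries.map (substAlgHom (R := R) hb).toRingHom with
      commutes' := fun r => by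
        change PowerSeries.map _ (algebraMap R _ r) = _
        rw [IsScalarTower.algebraMap_apply R (MvPowerSeries σ R),
          IsScalarTower.algebraMap_apply R (MvPowerSeries τ R) (PowerSeries _)]
        change PowerSeries.map _ (PowerSeries.C _) = PowerSeries.C _
        rw [PowerSeries.map_C]
        exact congrArg _ ((substAlgHom (R := R) hb).commutes r) }
  have key := algHom_subst_of_continuous HasSubst.X
    (((optionEquivLeft τ R).symm.toAlgHom.comp m).comp (optionEquivLeft σ R).toAlgHom) (by
    intro _ _
    refine continuous_pi fun x => ?_
    have h1 : Continuous fun p : MvPowerSeries (Option σ) R =>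
        PowerSeries.coeff (x none) (optionEquivLeft σ R p) := by
      refine continuous_pi fun y => ?_
      exact (WithPiTopology.continuous_coeff R (y.optionElim (x none))).congr fun p =>
        (coeff_coeff_optionEquivLeft p _ y).symm
    refine ((WithPiTopology.continuous_coeff R x.some).comp
      ((continuous_subst hb).comp h1)).congr fun p => ?_
    obtain ⟨q, hq⟩ : ∃ q, m (optionEquivLeft σ R p) = optionEquivLeft τ R q :=
      ⟨_, ((optionEquivLeft τ R).apply_symm_apply _).symm⟩
    have hx : x = x.some.optionElim (x none) := by ext (_ | i) <;> simp
    change coeff x.some (subst b _) = coeff x ((optionEquivLeft τ R).symm (m (optionEquivLeft σ R p)))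
    have hm : PowerSeries.coeff (x none) (m (optionEquivLeft σ R p)) =
        subst b (PowerSeries.coeff (x none) (optionEquivLeft σ R p)) := by
      rw [← coe_substAlgHom hb]
      exact PowerSeries.coeff_map _ _ _
    rw [← hm, hq, AlgEquiv.symm_apply_apply]
    conv_rhs => rw [hx]
    rw [coeff_coeff_optionEquivLeft]) p
  have hX : (fun i => (optionEquivLeft τ R).symm (m (optionEquivLeft σ R (X i)))) =
      extendSubst b := by
    funext i
    rw [AlgEquiv.symm_apply_eq]
    cases i with
    | none =>
      rw [optionEquivLeft_X_none]
      exact (PowerSeries.map_X _).trans optionEquivLeft_X_none.symm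
    | some i =>
      rw [optionEquivLeft_X_some, extendSubst, optionEquivLeft_rename_some]
      refine (PowerSeries.map_C _ _).trans (congrArg _ ?_)
      exact (substAlgHom_X hb i)
  rw [subst_self] at key
  have key2 := congrArg (optionEquivLeft τ R) key
  change optionEquivLeft τ R ((optionEquivLeft τ R).symm (m (optionEquivLeft σ R p))) = _ at key2
  rw [AlgEquiv.apply_symm_apply] at key2
  exact (key2.trans (congrArg (fun a => optionEquivLeft τ R (subst a p)) hX)).symm

end General

/-! ### Derivations, partial derivatives and proportional power series -/

section General

variable {σ τ R : Type} [CommRing R]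

open scoped MvPowerSeries.WithPiTopology in
/-- If a continuous derivation maps the values of all variables under a substitution into the ideal
`(X s ^ n)`, then it maps every substituted power series into it: this holds for polynomials by the
Leibniz rule, and the ideal is closed. -/
theorem X_pow_dvd_derivation_subst {a : σ → MvPowerSeries τ R} (ha : HasSubst a)
    (d : Derivation R (MvPowerSeries τ R) (MvPowerSeries τ R))
    (hd : ∀ [UniformSpace R] [DiscreteUniformity R], Continuous d) (s : τ) (n : ℕ)
    (h : ∀ i, X s ^ n ∣ d (a i)) (f : MvPowerSeries σ R) :
    X s ^ n ∣ d (subst a f) := by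
  let : UniformSpace R := ⊥
  rw [X_pow_dvd_iff]
  intro m hm
  have hc : Continuous fun f : MvPowerSeries σ R => coeff m (d (subst a f)) :=
    (WithPiTopology.continuous_coeff R m).comp (hd.comp (continuous_subst ha))
  refine WithPiTopology.denseRange_toMvPowerSeries.induction_on f
    (isClosed_singleton.preimage hc : IsClosed {f | coeff m (d (subst a f)) = 0}) fun p => ?_
  suffices X s ^ n ∣ d (subst a (p : MvPowerSeries σ R)) from X_pow_dvd_iff.mp this m hm
  simp only [← substAlgHom_apply ha]
  induction p using MvPolynomial.induction_on with
  | C r =>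
    have hr : substAlgHom ha ((MvPolynomial.C r : MvPolynomial σ R) : MvPowerSeries σ R) =
        algebraMap R _ r := by
      rw [MvPolynomial.coe_C]
      exact (substAlgHom (R := R) ha).commutes r
    rw [hr, Derivation.map_algebraMap]
    exact dvd_zero _
  | add p q hp hq =>
    rw [MvPolynomial.coe_add, map_add, map_add]
    exact dvd_add hp hq
  | mul_X p i hp =>
    rw [MvPolynomial.coe_mul, map_mul, Derivation.leibniz, MvPolynomial.coe_X, substAlgHom_X]
    exact dvd_add ((h i).mul_left _) (hp.mul_left _)

theorem coeff_rename_some (f : MvPowerSeries σ R) (m : Option σ →₀ ℕ) :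
    coeff m (rename Function.Embedding.some f) = if m none = 0 then coeff m.some f else 0 := by
  have hm : m = m.some.optionElim (m none) := by ext (_ | i) <;> simp
  conv_lhs => rw [hm]
  rw [← coeff_coeff_optionEquivLeft, optionEquivLeft_rename_some, PowerSeries.coeff_C]
  split_ifs <;> simp

theorem pderiv_some_rename (f : MvPowerSeries σ R) (k : σ) :
    pderiv R (some k) (rename Function.Embedding.some f) =
      rename Function.Embedding.some (pderiv R k f) := by
  classical
  ext m
  have h : (m + Finsupp.single (some k) 1).some = m.some + Finsupp.single k 1 := by
    ext i; simp [Finsupp.single_apply]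
  rw [coeff_pderiv, coeff_rename_some, coeff_rename_some, h]
  simp [coeff_pderiv]

theorem pderiv_none_rename (f : MvPowerSeries σ R) :
    pderiv R none (rename Function.Embedding.some f) = 0 := by
  ext m
  rw [coeff_pderiv, coeff_rename_some]
  simp

theorem coeff_X_mul_pderiv (f : MvPowerSeries σ R) (k : σ) (m : σ →₀ ℕ) :
    coeff m (X k * pderiv R k f) = (m k : R) * coeff m f := by
  by_cases hk : m k = 0
  · rw [X_dvd_iff.mp (Dvd.intro _ rfl) m hk, hk, Nat.cast_zero, zero_mul]
  · obtain ⟨m, rfl⟩ : ∃ m', m = Finsupp.single k 1 + m' := by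
      refine exists_add_of_le ?_
      simpa [Nat.one_le_iff_ne_zero] using hk
    rw [X, coeff_add_monomial_mul, coeff_pderiv, one_mul, add_comm m, mul_comm]
    simp [add_comm]

/-- Variant of `MvPowerSeries.coeff_mul_of_add_lexOrder` in which `p` and `q` are only lower bounds
of the leading exponents. -/
theorem coeff_add_mul_of_le_lexOrder [LinearOrder σ] [WellFoundedGT σ] {φ ψ : MvPowerSeries σ R}
    {p q : σ →₀ ℕ} (hp : toLex p ≤ lexOrder φ) (hq : toLex q ≤ lexOrder ψ) :
    coeff (p + q) (φ * ψ) = coeff p φ * coeff q ψ := by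
  classical
  rw [coeff_mul, Finset.sum_eq_single_of_mem ⟨p, q⟩ (by simp)]
  rintro ⟨u, v⟩ h h'
  replace h := Finset.HasAntidiagonal.mem_antidiagonal.mp h
  rcases trichotomy_of_add_eq_add (congrArg toLex h) with h'' | h'' | h''
  · exact False.elim (h' (Prod.ext h''.1 h''.2))
  · rw [coeff_eq_zero_of_lt_lexOrder (d := u), zero_mul]
    exact lt_of_lt_of_le (by norm_cast) hp
  · rw [coeff_eq_zero_of_lt_lexOrder (d := v), mul_zero]
    exact lt_of_lt_of_le (by norm_cast) hq

end General

section Proportional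

variable {σ K : Type} [Field K] [CharZero K]

/-- Two power series with the same logarithmic derivatives are proportional. -/
theorem exists_eq_C_mul_of_mul_pderiv_eq {f g : MvPowerSeries σ K} (hg : g ≠ 0)
    (h : ∀ k, pderiv K k f * g = f * pderiv K k g) : ∃ c : K, f = C c * g := by
  -- The lexicographic order of a power series needs a linear order without infinite ascending
  -- chains on the variables: take the dual of a well-order.
  obtain ⟨_, _⟩ := exists_wellFoundedLT σ
  have hwf : WellFoundedGT σᵒᵈ := inferInstance
  let : LinearOrder σ := inferInstanceAs (LinearOrder σᵒᵈ)
  have : WellFoundedGT σ := hwf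
  obtain ⟨d, hd⟩ := exists_finsupp_eq_lexOrder_of_ne_zero hg
  have hgd : coeff d g ≠ 0 := coeff_ne_zero_of_lexOrder hd.symm
  refine ⟨coeff d f / coeff d g, ?_⟩
  -- This `c` makes the coefficient of `r = f - c g` at the leading exponent `d` of `g` vanish.
  set c := coeff d f / coeff d g with hc
  by_contra hne
  have hr : f - C c * g ≠ 0 := sub_ne_zero.mpr hne
  set r := f - C c * g with hrdef
  have hrd : coeff d r = 0 := by
    rw [hrdef, map_sub, coeff_C_mul, hc, div_mul_cancel₀ _ hgd, sub_self]
  have hrk : ∀ k, pderiv K k r * g = r * pderiv K k g := by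
    intro k
    rw [hrdef, map_sub, Derivation.leibniz, pderiv_C, smul_zero, add_zero, smul_eq_mul]
    linear_combination h k
  obtain ⟨e, he⟩ := exists_finsupp_eq_lexOrder_of_ne_zero hr
  have hre : coeff e r ≠ 0 := coeff_ne_zero_of_lexOrder he.symm
  have hle : ∀ (φ : MvPowerSeries σ K) (k : σ), lexOrder φ ≤ lexOrder (X k * pderiv K k φ) := by
    intro φ k
    rw [le_lexOrder_iff]
    intro m hm
    rw [coeff_X_mul_pderiv, coeff_eq_zero_of_lt_lexOrder hm, mul_zero]
  -- Comparing the coefficients of `X ^ (e + d)` in `(X_k ∂_k r) g = r (X_k ∂_k g)` gives `e_k = d_k`.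
  have hed : e = d := by
    ext k
    have h1 : X k * pderiv K k r * g = r * (X k * pderiv K k g) := by
      linear_combination X k * hrk k
    have h2 := congrArg (coeff (e + d)) h1
    rw [coeff_add_mul_of_le_lexOrder (he.symm.le.trans (hle r k)) hd.symm.le,
      coeff_add_mul_of_le_lexOrder he.symm.le (hd.symm.le.trans (hle g k)),
      coeff_X_mul_pderiv, coeff_X_mul_pderiv] at h2
    have h3 : ((e k : K) - d k) * (coeff e r * coeff d g) = 0 := by linear_combination h2
    rcases mul_eq_zero.mp h3 with h4 | h4
    · exact_mod_cast sub_eq_zero.mp h4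
    · exact absurd h4 (mul_ne_zero hre hgd)
  exact hre (hed ▸ hrd)

end Proportional

/-! ### The Miwa shift and its invariants -/

/-- Formal functions of `𝐭` and of the spectral parameter `w`, the variable `none`. -/
abbrev SpecTime : Type := MvPowerSeries (Option ℕ+) ℂ

/-- A function of `𝐭`, regarded as a function of `(𝐭, w)` that is constant in `w`. -/
noncomputable def constT : OneTime →ₐ[ℂ] SpecTime := rename Function.Embedding.some

theorem hasSubst_shift (ε : ℂ) : HasSubst (miwaSubst (id : ℕ+ → ℕ+) id fun _ => ε) :=
  hasSubst_miwaSubst id Function.injective_id id (fun m => Set.finite_singleton m) _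

/-- `f(𝐭 + ε[w])` as a function of `(𝐭, w)`. -/
noncomputable def shiftHom (ε : ℂ) : OneTime →ₐ[ℂ] SpecTime := substAlgHom (hasSubst_shift ε)

theorem optionEquivLeft_constT (f : OneTime) : optionEquivLeft ℕ+ ℂ (constT f) = PowerSeries.C f :=
  optionEquivLeft_rename_some f

theorem optionEquivLeft_shiftHom (ε : ℂ) (f : OneTime) :
    optionEquivLeft ℕ+ ℂ (shiftHom ε f) = shiftT ε f := by
  rw [shiftHom, substAlgHom_apply]; rfl

theorem constantCoeff_miwa_id {ι : Type} {k : ι → ℕ+} {ε : ι → ℂ}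
    (h : HasSubst (miwaSubst id k ε)) (f : MvPowerSeries ι ℂ) :
    PowerSeries.constantCoeff (miwa id k ε f) = f := by
  rw [miwa, constantCoeff_optionEquivLeft_subst h]
  conv_rhs => rw [← id_eq f, ← subst_self]
  congr 1
  funext i
  simp [miwaSubst]

theorem constantCoeff_shiftT (ε : ℂ) (f : OneTime) :
    PowerSeries.constantCoeff (shiftT ε f) = f :=
  constantCoeff_miwa_id (hasSubst_shift ε) f

theorem shiftHom_ne_zero (ε : ℂ) {f : OneTime} (hf : f ≠ 0) : shiftHom ε f ≠ 0 := by
  intro h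
  apply hf
  rw [← constantCoeff_shiftT ε f, ← optionEquivLeft_shiftHom, h, map_zero, map_zero]

theorem constT_ne_zero {f : OneTime} (hf : f ≠ 0) : constT f ≠ 0 :=
  (map_ne_zero_iff _ (rename_injective _)).mpr hf

theorem X_none_prime : Prime (X none : SpecTime) := by
  rw [← MulEquiv.prime_iff (optionEquivLeft ℕ+ ℂ), optionEquivLeft_X_none]
  have : IsDomain OneTime := NoZeroDivisors.to_isDomain _
  exact PowerSeries.X_prime

theorem not_X_none_dvd_shiftHom (ε : ℂ) {f : OneTime} (hf : f ≠ 0) :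
    ¬ (X none : SpecTime) ∣ shiftHom ε f := by
  intro h
  have h2 := map_dvd (optionEquivLeft ℕ+ ℂ) h
  rw [optionEquivLeft_X_none, optionEquivLeft_shiftHom, PowerSeries.X_dvd_iff,
    constantCoeff_shiftT] at h2
  exact hf h2

section Euler

variable {R : Type} [CommRing R]

/-- The derivation `w ∂_w + ∑_{1 ≤ k ≤ N} w ^ k ∂_k`, with `w` the variable `none`.  The sum is cut off
at `N`, so that it is finite; only the terms up to `w ^ N` are meaningful. -/
noncomputable def eulerDeriv (R : Type) [CommRing R] (N : ℕ) :
    Derivation R (MvPowerSeries (Option ℕ+) R) (MvPowerSeries (Option ℕ+) R) :=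
  (X none : MvPowerSeries (Option ℕ+) R) • pderiv R none +
    ∑ k ∈ Finset.range N,
      (X none : MvPowerSeries (Option ℕ+) R) ^ (k + 1) • pderiv R (some k.succPNat)

theorem eulerDeriv_apply (N : ℕ) (P : MvPowerSeries (Option ℕ+) R) :
    eulerDeriv R N P = X none * pderiv R none P +
      ∑ k ∈ Finset.range N, X none ^ (k + 1) * pderiv R (some k.succPNat) P := by
  have h := congrFun (map_sum Derivation.coeFnAddMonoidHom (fun k : ℕ =>
    (X none : MvPowerSeries (Option ℕ+) R) ^ (k + 1) • pderiv R (some k.succPNat))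
    (Finset.range N)) P
  rw [eulerDeriv, Derivation.add_apply]
  refine congrArg _ (h.trans ?_)
  rw [Finset.sum_apply]
  rfl

open scoped MvPowerSeries.WithPiTopology in
theorem continuous_pderiv {σ : Type} [UniformSpace R] [DiscreteUniformity R]
    (i : σ) : Continuous (pderiv R i) := by
  refine continuous_pi fun m => ?_
  exact ((continuous_of_discreteTopology (f := fun r : R => r * (m i + 1))).comp
    (WithPiTopology.continuous_coeff R (m + Finsupp.single i 1))).congr fun f =>
      (coeff_pderiv f m).symm

open scoped MvPowerSeries.WithPiTopology in
theorem continuous_eulerDeriv [UniformSpace R] [DiscreteUniformity R] (N : ℕ) :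
    Continuous (eulerDeriv R N) := by
  have h : Continuous fun P : MvPowerSeries (Option ℕ+) R => X none * pderiv R none P +
      ∑ k ∈ Finset.range N, X none ^ (k + 1) * pderiv R (some k.succPNat) P :=
    (continuous_const.mul (continuous_pderiv none)).add
      (continuous_finsetSum _ fun k _ => continuous_const.mul (continuous_pderiv _))
  exact h.congr fun P => (eulerDeriv_apply N P).symm

end Euler

/-- Up to the cut-off, the derivation `w ∂_w + ∑_k w ^ k ∂_k` annihilates `f(𝐭-[w])`, because it
annihilates each `t_k - w ^ k / k`. -/
theorem X_pow_dvd_eulerDeriv_shiftHom (N : ℕ) (f : OneTime) :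
    X none ^ (N + 1) ∣ eulerDeriv ℂ N (shiftHom (-1) f) := by
  rw [shiftHom, substAlgHom_apply]
  refine X_pow_dvd_derivation_subst (hasSubst_shift (-1)) (eulerDeriv ℂ N)
    (continuous_eulerDeriv N) none (N + 1) (fun i => ?_) f
  have hX : ∀ k, pderiv ℂ (some k) (miwaSubst (id : ℕ+ → ℕ+) id (fun _ => -1) i) =
      if k = i then 1 else 0 := by
    intro k
    rw [miwaSubst, map_add, Derivation.leibniz, pderiv_C, smul_zero, add_zero,
      pderiv_pow, pderiv_X_of_ne (by simp : (none : Option ℕ+) ≠ some k)]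
    split_ifs with h
    · subst h; simp
    · rw [pderiv_X_of_ne (by simpa using Ne.symm h)]; simp
  have hi : ((i : ℕ) : ℂ) ≠ 0 := by simp
  have hw : X none * pderiv ℂ none (miwaSubst (id : ℕ+ → ℕ+) id (fun _ => -1) i) =
      -(X none) ^ (i : ℕ) := by
    rw [miwaSubst, map_add, Derivation.leibniz, pderiv_C, smul_zero, add_zero,
      pderiv_pow, pderiv_X_self, pderiv_X_of_ne (by simp)]
    have hc : (C (-1 / ((i : ℕ) : ℂ)) : SpecTime) * ((i : ℕ) : SpecTime) = -1 := by
      rw [← map_natCast (C (σ := Option ℕ+) (R := ℂ)), ← map_mul, div_mul_cancel₀ _ hi, map_neg,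
        map_one]
    have hp : (X none : SpecTime) * X none ^ ((i : ℕ) - 1) = X none ^ (i : ℕ) := by
      rw [← pow_succ', Nat.sub_add_cancel i.pos]
    simp only [id, smul_eq_mul, zero_add, mul_one]
    linear_combination (X none * X none ^ ((i : ℕ) - 1)) * hc - hp
  rw [eulerDeriv_apply, hw]
  simp only [hX]
  rcases le_or_gt (i : ℕ) N with h | h
  · rw [Finset.sum_eq_single_of_mem ((i : ℕ) - 1)
      (by have := i.pos; exact Finset.mem_range.mpr (by omega))]
    · rw [if_pos (show ((i : ℕ) - 1).succPNat = i from PNat.succPNat_natPred i),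
        Nat.sub_add_cancel i.pos]
      simp
    · intro k _ hk
      rw [if_neg (by rintro rfl; exact hk (by rw [Nat.succPNat_coe]; rfl)), mul_zero]
  · rw [Finset.sum_eq_zero, add_zero]
    · exact (pow_dvd_pow _ h).neg_right
    · intro k hk
      rw [if_neg, mul_zero]
      rintro rfl
      have hk' := Finset.mem_range.mp hk
      rw [Nat.succPNat_coe] at h
      omega

theorem eulerDeriv_constT (N : ℕ) (f : OneTime) :
    eulerDeriv ℂ N (constT f) =
      ∑ k ∈ Finset.range N, X none ^ (k + 1) * constT (pderiv ℂ k.succPNat f) := by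
  rw [eulerDeriv_apply, constT, pderiv_none_rename, mul_zero, zero_add]
  simp only [pderiv_some_rename]

/-- If `f(𝐭) g(𝐭-[w]) = f(𝐭-[w]) g(𝐭)` then `f` is a constant multiple of `g`. -/
theorem exists_eq_C_mul_of_shiftHom {f g : OneTime} (hg : g ≠ 0)
    (h : constT f * shiftHom (-1) g = shiftHom (-1) f * constT g) : ∃ c : ℂ, f = C c * g := by
  refine exists_eq_C_mul_of_mul_pderiv_eq hg fun k => ?_
  obtain ⟨N, rfl⟩ : ∃ N : ℕ, k = N.succPNat := ⟨k.natPred, by simp⟩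
  obtain ⟨u, hu⟩ := X_pow_dvd_eulerDeriv_shiftHom (N + 1) f
  obtain ⟨v, hv⟩ := X_pow_dvd_eulerDeriv_shiftHom (N + 1) g
  have hD := congrArg (eulerDeriv ℂ (N + 1)) h
  simp only [Derivation.leibniz, smul_eq_mul] at hD
  -- The equation differentiated, multiplied by `g(𝐭)` and combined with the equation itself.
  have hdvd : X none ^ (N + 1 + 1) ∣ (eulerDeriv ℂ (N + 1) (constT f) * constT g -
      constT f * eulerDeriv ℂ (N + 1) (constT g)) * shiftHom (-1) g := by
    refine ⟨constT g * (constT g * u - constT f * v), ?_⟩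
    rw [hu, hv] at hD
    linear_combination constT g * hD - eulerDeriv ℂ (N + 1) (constT g) * h
  have hdvd2 := X_none_prime.pow_dvd_of_dvd_mul_right _ (not_X_none_dvd_shiftHom (-1) hg) hdvd
  rw [eulerDeriv_constT, eulerDeriv_constT, Finset.sum_mul, Finset.mul_sum,
    ← Finset.sum_sub_distrib] at hdvd2
  have h3 := map_dvd (optionEquivLeft ℕ+ ℂ) hdvd2
  rw [map_pow, optionEquivLeft_X_none, PowerSeries.X_pow_dvd_iff] at h3
  -- The coefficient of `w ^ (N + 1)` is `∂_{N+1} f * g - f * ∂_{N+1} g`.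
  have h4 := h3 (N + 1) (by omega)
  simp only [map_sum, map_sub, map_mul, map_pow, optionEquivLeft_constT, optionEquivLeft_X_none]
    at h4
  have h5 : ∀ k, (PowerSeries.coeff (N + 1)) (PowerSeries.X ^ (k + 1) *
      PowerSeries.C (pderiv ℂ k.succPNat f) * PowerSeries.C g) -
      (PowerSeries.coeff (N + 1)) (PowerSeries.C f * (PowerSeries.X ^ (k + 1) *
      PowerSeries.C (pderiv ℂ k.succPNat g))) =
      if k = N then pderiv ℂ k.succPNat f * g - f * pderiv ℂ k.succPNat g else 0 := by
    intro k
    rw [PowerSeries.coeff_mul_C, PowerSeries.coeff_C_mul, PowerSeries.coeff_mul_C,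
      PowerSeries.coeff_mul_C, PowerSeries.coeff_X_pow]
    by_cases hk : k = N
    · subst hk; simp
    · rw [if_neg (by omega), if_neg hk]; simp
  simp only [h5] at h4
  rw [Finset.sum_ite_eq' , if_pos (by simp)] at h4
  exact sub_eq_zero.mp h4

/-! ### Miwa shifts off the slice -/

/-- `slice` as an algebra map. -/
noncomputable def sliceHom : TwoTime →ₐ[ℂ] OneTime := substAlgHom hasSubst_slice

theorem sliceHom_apply (F : TwoTime) : sliceHom F = slice F := substAlgHom_apply hasSubst_slice F

theorem hasSubst_shiftTwo (ε δ : ℂ) : HasSubst (miwaSubst (id : ℕ+ ⊕ ℕ+ → ℕ+ ⊕ ℕ+)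
    (Sum.elim id id) (Sum.elim (fun _ => ε) (fun _ => δ))) := by
  refine hasSubst_miwaSubst id Function.injective_id _ (fun m => ?_) _
  refine (Set.toFinite {Sum.inl m, Sum.inr m}).subset ?_
  rintro (i | i) (rfl : i = m)
  · exact Or.inl rfl
  · exact Or.inr rfl

/-- `F(𝐭 + ε[w], -𝐭 + δ[w])` as a function of `(𝐭, w)`. -/
noncomputable def sliceShift (ε δ : ℂ) : TwoTime →ₐ[ℂ] SpecTime :=
  (substAlgHom (hasSubst_extendSubst hasSubst_slice)).comp (substAlgHom (hasSubst_shiftTwo ε δ))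

theorem coeff_sliceShift (ε δ : ℂ) (F : TwoTime) (j : ℕ) :
    PowerSeries.coeff j (optionEquivLeft ℕ+ ℂ (sliceShift ε δ F)) =
      slice (PowerSeries.coeff j (miwa id (Sum.elim id id)
        (Sum.elim (fun _ => ε) (fun _ => δ)) F)) := by
  rw [sliceShift, AlgHom.comp_apply, substAlgHom_apply, substAlgHom_apply,
    optionEquivLeft_subst_extendSubst hasSubst_slice]
  exact (PowerSeries.coeff_map _ _ _).trans (sliceHom_apply _)

theorem constantCoeff_sliceShift (ε δ : ℂ) (F : TwoTime) :
    PowerSeries.constantCoeff (optionEquivLeft ℕ+ ℂ (sliceShift ε δ F)) = slice F := by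
  rw [← PowerSeries.coeff_zero_eq_constantCoeff_apply, coeff_sliceShift,
    PowerSeries.coeff_zero_eq_constantCoeff_apply, constantCoeff_miwa_id (hasSubst_shiftTwo ε δ)]

theorem hasSubst_translate : HasSubst (fun i : Option ℕ+ =>
    i.elim (X none : SpecTime) (miwaSubst (id : ℕ+ → ℕ+) id fun _ => -1)) :=
  hasSubst_option (hasSubst_shift (-1)) (constantCoeff_X none)

/-- The substitution `(𝐭, w) ↦ (𝐭 - [w], w)`. -/
noncomputable def translate : SpecTime →ₐ[ℂ] SpecTime := substAlgHom hasSubst_translate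

/-- A composite of two substitutions is determined by the values of the variables. -/
theorem substAlgHom_ext {σ τ υ R : Type} [CommRing R] {a : σ → MvPowerSeries τ R}
    {b : τ → MvPowerSeries υ R} {c : σ → MvPowerSeries υ R}
    (ha : HasSubst a) (hb : HasSubst b) (hc : HasSubst c)
    (h : ∀ i, substAlgHom (R := R) hb (a i) = c i) (f : MvPowerSeries σ R) :
    substAlgHom (R := R) hb (substAlgHom (R := R) ha f) = substAlgHom (R := R) hc f := by
  rw [substAlgHom_comp_substAlgHom_apply]
  simp only [substAlgHom_apply, h]

theorem translate_X_none : translate (X none) = X none := substAlgHom_X _ _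

theorem translate_X_some (k : ℕ+) : translate (X (some k)) =
    X (some k) + C (-1 / ((k : ℕ) : ℂ)) * X none ^ (k : ℕ) := substAlgHom_X _ _

theorem translate_C (r : ℂ) : translate (C r) = C r := translate.commutes r

theorem constT_eq (f : OneTime) : constT f =
    substAlgHom (HasSubst.X_comp (R := ℂ) (f := (Function.Embedding.some : ℕ+ ↪ Option ℕ+))) f := by
  rw [constT, rename_eq_subst, substAlgHom_apply]

theorem translate_constT (f : OneTime) : translate (constT f) = shiftHom (-1) f := by
  rw [constT_eq, translate, shiftHom]
  refine substAlgHom_ext _ _ _ (fun k => ?_) f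
  exact translate_X_some k

theorem translate_shiftHom_one (f : OneTime) : translate (shiftHom 1 f) = constT f := by
  rw [constT_eq, translate, shiftHom]
  refine substAlgHom_ext _ _ _ (fun k => ?_) f
  change translate _ = X (some k)
  rw [miwaSubst, map_add, map_mul, map_pow, translate_C, translate_X_none]
  simp only [id, translate_X_some, neg_div, map_neg]
  ring

/-- The values of `x_k`, `y_k` under `(x, y) = (𝐭 + ε[w], -𝐭 + δ[w])`. -/
noncomputable def sliceShiftVar (ε δ : ℂ) : ℕ+ ⊕ ℕ+ → SpecTime :=
  Sum.elim (fun k => X (some k) + C (ε / ((k : ℕ) : ℂ)) * X none ^ (k : ℕ))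
    (fun k => -X (some k) + C (δ / ((k : ℕ) : ℂ)) * X none ^ (k : ℕ))

theorem substAlgHom_extendSubst_miwaSubst (ε δ : ℂ) (i : ℕ+ ⊕ ℕ+) :
    substAlgHom (R := ℂ) (hasSubst_extendSubst hasSubst_slice)
      (miwaSubst id (Sum.elim id id) (Sum.elim (fun _ => ε) (fun _ => δ)) i) =
      sliceShiftVar ε δ i := by
  have hC : ∀ r : ℂ, substAlgHom (R := ℂ) (hasSubst_extendSubst hasSubst_slice) (C r) = C r :=
    fun r => (substAlgHom (R := ℂ) (hasSubst_extendSubst hasSubst_slice)).commutes r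
  rw [miwaSubst, map_add, map_mul, map_pow, hC, substAlgHom_X, substAlgHom_X]
  rcases i with k | k <;> simp [sliceShiftVar, extendSubst]

theorem hasSubst_sliceShiftVar (ε δ : ℂ) : HasSubst (sliceShiftVar ε δ) := by
  have h := (hasSubst_shiftTwo ε δ).comp (hasSubst_extendSubst hasSubst_slice)
  rwa [funext (substAlgHom_extendSubst_miwaSubst ε δ)] at h

theorem sliceShift_eq (ε δ : ℂ) (F : TwoTime) :
    sliceShift ε δ F = substAlgHom (hasSubst_sliceShiftVar ε δ) F :=
  substAlgHom_ext (hasSubst_shiftTwo ε δ) _ _ (substAlgHom_extendSubst_miwaSubst ε δ) F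

/-- The substitution `𝐭 ↦ 𝐭 - [w]` turns `F(𝐭, -𝐭-[w])` into `F(𝐭-[w], -𝐭)`, since
`-(𝐭 - [w]) - [w] = -𝐭`.  This links the two Toda wave functions. -/
theorem translate_sliceShift (F : TwoTime) :
    translate (sliceShift 0 (-1) F) = sliceShift (-1) 0 F := by
  rw [sliceShift_eq, sliceShift_eq]
  refine substAlgHom_ext _ _ _ (fun i => ?_) F
  change translate _ = _
  rcases i with k | k <;>
  · simp only [sliceShiftVar, Sum.elim_inl, Sum.elim_inr, map_add, map_neg, map_mul, map_pow,
      translate_C, translate_X_none, translate_X_some, neg_div, zero_div, map_zero]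
    ring

/-- Suppose that `F(𝐭, -𝐭-[w]) D(𝐭) = G(𝐭) B(𝐭, w)` and `F(𝐭-[w], -𝐭) D(𝐭) = G(𝐭) B(𝐭-[w], w)`.
Replacing `𝐭` by `𝐭 - [w]` in the former gives another expression for `F(𝐭-[w], -𝐭)`, so that `G / D` is
invariant under the shift, hence constant. -/
theorem exists_eq_C_mul_of_sliceShift {F : TwoTime} {G D : OneTime} {B : SpecTime} (hD : D ≠ 0)
    (hB : translate B ≠ 0) (h₂ : sliceShift 0 (-1) F * constT D = constT G * B)
    (h₁ : sliceShift (-1) 0 F * constT D = constT G * translate B) :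
    ∃ c : ℂ, G = C c * D := by
  refine exists_eq_C_mul_of_shiftHom hD ?_
  have h := congrArg translate h₂
  rw [map_mul, map_mul, translate_sliceShift, translate_constT, translate_constT] at h
  refine mul_right_cancel₀ hB ?_
  linear_combination constT D * h - shiftHom (-1) D * h₁

/-! ### Coefficients of difference operators -/

namespace DiffOp

theorem act_zPow (A : DiffOp) (n m : ℤ) : A.act zPow n m = A (m - n) n := by
  rw [act, finsum_eq_single _ (m - n)]
  · simp [zPow]
  · intro j hj
    rw [zPow, if_neg (by omega), mul_zero]

theorem act_zPowNeg (A : DiffOp) (n m : ℤ) :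
    A.act zPowNeg n m = A (-n - 1 - m) n := by
  rw [act, finsum_eq_single _ (-n - 1 - m)]
  · rw [zPowNeg, if_pos (by omega), mul_one]
  · intro j hj
    rw [zPowNeg, if_neg (by omega), mul_zero]

theorem mulBy_comp (f : ℤ → TimeField) (B : DiffOp) (m n : ℤ) :
    (mulBy f).comp B m n = f n * B m n := by
  rw [comp, finsum_eq_single _ 0]
  · simp [mulBy]
  · intro j hj
    rw [mulBy, if_neg hj, zero_mul]

theorem comp_shift (A : DiffOp) (k m n : ℤ) : A.comp (shift k) m n = A (m - k) n := by
  rw [comp, finsum_eq_single _ (m - k)]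
  · simp [shift]
  · intro j hj
    rw [shift, if_neg (by omega), mul_zero]

theorem mulBy_comp_delta_comp (f : ℤ → TimeField) (B : DiffOp) (m n : ℤ) :
    ((mulBy f).comp delta).comp B m n = f n * (B (m - 1) (n + 1) - B m n) := by
  have h : ∀ i : ℤ, (mulBy f).comp delta i n =
      f n * ((if i = 1 then 1 else 0) - if i = 0 then 1 else 0) := fun i => mulBy_comp _ _ _ _
  rw [comp, finsum_eq_sum_of_support_subset (s := {0, 1})]
  · simp [h]
    ring
  · intro i hi
    by_contra hne
    simp only [Finset.coe_insert, Finset.coe_singleton, Set.mem_insert_iff,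
      Set.mem_singleton_iff, not_or] at hne
    exact hi (by simp [h, hne.1, hne.2])

end DiffOp

/-! ### The wave functions on the slice -/

section Wave

variable {τ : ℤ → OneTime} {Sp Sm : DiffOp}

theorem zcoeff_natCast_sub_one {R : Type} [CommRing R] (P : PowerSeries R) (j : ℕ) :
    zcoeff P ((j : ℤ) - 1) = PowerSeries.coeff j (PowerSeries.X * P) := by
  cases j with
  | zero => simp [zcoeff]
  | succ j => simp [zcoeff, PowerSeries.coeff_succ_X_mul]

theorem zcoeff_natCast {R : Type} [CommRing R] (P : PowerSeries R) (j : ℕ) :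
    zcoeff P (j : ℤ) = PowerSeries.coeff j P := by simp [zcoeff]

theorem IsWaveOperators.plus_coeff (hS : IsWaveOperators τ Sp Sm) (j n : ℤ) :
    Sp j n = algebraMap OneTime TimeField (zcoeff (shiftT (-1) (τ (n - 1))) (-j)) /
      algebraMap OneTime TimeField (τ n) := by
  have h := congrFun (congrFun hS.plus_act n) (n + j)
  rw [DiffOp.act_zPow, psiPlus] at h
  convert h using 4 <;> ring

theorem IsWaveOperators.minus_coeff (hS : IsWaveOperators τ Sp Sm) (j n : ℤ) :
    Sm.adjoint j n = algebraMap OneTime TimeField (zcoeff (shiftT 1 (τ (n + 1))) j) /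
      algebraMap OneTime TimeField (τ n) := by
  have h := congrFun (congrFun hS.minus_act n) (-n - 1 - j)
  rw [DiffOp.act_zPowNeg, psiMinus] at h
  convert h using 4 <;> ring

theorem IsWaveOperators.b₀_eq (hS : IsWaveOperators τ Sp Sm) (n : ℤ) :
    b₀ Sp n = algebraMap OneTime TimeField (τ (n - 1)) / algebraMap OneTime TimeField (τ n) := by
  rw [b₀, hS.plus_coeff]
  have h := zcoeff_natCast (shiftT (-1) (τ (n - 1))) 0
  rw [PowerSeries.coeff_zero_eq_constantCoeff_apply, constantCoeff_shiftT] at h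
  simpa using congrArg
    (fun x => algebraMap OneTime TimeField x / algebraMap OneTime TimeField (τ n)) h

theorem algebraMap_ne_zero {f : OneTime} (hf : f ≠ 0) : algebraMap OneTime TimeField f ≠ 0 :=
  (map_ne_zero_iff _ (IsFractionRing.injective OneTime TimeField)).mpr hf

variable {F : ℤ → TwoTime}

/-- An identity between shifted functions may be checked coefficient by coefficient in `w`. -/
theorem eq_of_coeff {F : TwoTime} {ε δ : ℂ} {D G : OneTime} {B : SpecTime}
    (h : ∀ j : ℕ, slice (PowerSeries.coeff j (miwa id (Sum.elim id id)
        (Sum.elim (fun _ => ε) (fun _ => δ)) F)) * D =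
      G * PowerSeries.coeff j (optionEquivLeft ℕ+ ℂ B)) :
    sliceShift ε δ F * constT D = constT G * B := by
  apply (optionEquivLeft ℕ+ ℂ).injective
  ext1 j
  rw [map_mul (optionEquivLeft ℕ+ ℂ), map_mul (optionEquivLeft ℕ+ ℂ), optionEquivLeft_constT,
    optionEquivLeft_constT, PowerSeries.coeff_mul_C, PowerSeries.coeff_C_mul, coeff_sliceShift, h]

theorem T₁_comp (Sp B : DiffOp) (m n : ℤ) : (T₁ Sp).comp B m n = (b₀ Sp n)⁻¹ * B m n :=
  DiffOp.mulBy_comp _ _ _ _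

theorem T₂_comp (Sp B : DiffOp) (m n : ℤ) :
    (T₂ Sp).comp B m n = (b₀ Sp (n + 1))⁻¹ * (B (m - 1) (n + 1) - B m n) :=
  DiffOp.mulBy_comp_delta_comp _ _ _ _

/-- For `T₁`: `F_n(𝐭-[w], -𝐭) τ_{n-1}(𝐭) = F_n(𝐭, -𝐭) τ_{n-1}(𝐭-[w])`. -/
theorem psi₁_of_T₁ (hτ : ∀ n, τ n ≠ 0) (hS : IsWaveOperators τ Sp Sm)
    (hF : IsTodaTauOf F (miura₁ Sp Sm)) (n : ℤ) :
    sliceShift (-1) 0 (F n) * constT (τ (n - 1)) =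
      constT (slice (F n)) * shiftHom (-1) (τ (n - 1)) := by
  refine eq_of_coeff fun j => ?_
  have h : todaPsi₁ F n (n - j) = (T₁ Sp).comp Sp (n - j - n) n :=
    (congrFun (congrFun hF.psi₁ n) (n - j)).trans (DiffOp.act_zPow _ _ _)
  rw [T₁_comp, hS.b₀_eq, hS.plus_coeff, todaPsi₁,
    show n - (n - (j : ℤ)) = j by ring, show -(n - (j : ℤ) - n) = j by ring,
    zcoeff_natCast, zcoeff_natCast] at h
  have h0 := algebraMap_ne_zero (hτ n)
  have h1 := algebraMap_ne_zero (hτ (n - 1))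
  have h2 := algebraMap_ne_zero (hF.slice_ne_zero n)
  rw [optionEquivLeft_shiftHom]
  apply IsFractionRing.injective OneTime TimeField
  rw [map_mul, map_mul]
  field_simp at h
  exact h

/-- For `T₁`: `F_{n+1}(𝐭, -𝐭-[w]) τ_{n-1}(𝐭) = F_n(𝐭, -𝐭) τ_{n+1}(𝐭+[w])`. -/
theorem psi₂_of_T₁ (hτ : ∀ n, τ n ≠ 0) (hS : IsWaveOperators τ Sp Sm)
    (hF : IsTodaTauOf F (miura₁ Sp Sm)) (n : ℤ) :
    sliceShift 0 (-1) (F (n + 1)) * constT (τ (n - 1)) =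
      constT (slice (F n)) * shiftHom 1 (τ (n + 1)) := by
  refine eq_of_coeff fun j => ?_
  have h : todaPsi₂ F n (n + j) = (T₁ Sp).comp Sm.adjoint (n + j - n) n :=
    (congrFun (congrFun hF.psi₂ n) (n + j)).trans (DiffOp.act_zPow _ _ _)
  rw [T₁_comp, hS.b₀_eq, hS.minus_coeff, todaPsi₂, show n + (j : ℤ) - n = j by ring,
    zcoeff_natCast, zcoeff_natCast] at h
  have h0 := algebraMap_ne_zero (hτ n)
  have h1 := algebraMap_ne_zero (hτ (n - 1))
  have h2 := algebraMap_ne_zero (hF.slice_ne_zero n)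
  rw [optionEquivLeft_shiftHom]
  apply IsFractionRing.injective OneTime TimeField
  rw [map_mul, map_mul]
  field_simp at h
  exact h

/-- For `T₂`, `F_n(𝐭-[w], -𝐭) τ_n(𝐭)² =
F_n(𝐭, -𝐭) (τ_n(𝐭) τ_n(𝐭-[w]) - w τ_{n+1}(𝐭) τ_{n-1}(𝐭-[w]))`. -/
theorem psi₁_of_T₂ (hτ : ∀ n, τ n ≠ 0) (hS : IsWaveOperators τ Sp Sm)
    (hF : IsTodaTauOf F (miura₂ Sp Sm)) (n : ℤ) :
    sliceShift (-1) 0 (F n) * constT (τ n ^ 2) =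
      constT (slice (F n)) * (constT (τ n) * shiftHom (-1) (τ n) -
        X none * (constT (τ (n + 1)) * shiftHom (-1) (τ (n - 1)))) := by
  refine eq_of_coeff fun j => ?_
  have h : todaPsi₁ F n (n - j) =
      (((T₂ Sp).comp Sp).comp (DiffOp.shift (-1))) (n - j - n) n :=
    (congrFun (congrFun hF.psi₁ n) (n - j)).trans (DiffOp.act_zPow _ _ _)
  rw [DiffOp.comp_shift, T₂_comp, hS.b₀_eq, hS.plus_coeff, hS.plus_coeff, todaPsi₁,
    show n - (n - (j : ℤ)) = j by ring, show -(n - (j : ℤ) - n - -1 - 1) = j by ring,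
    show -(n - (j : ℤ) - n - -1) = j - 1 by ring, add_sub_cancel_right,
    zcoeff_natCast, zcoeff_natCast, zcoeff_natCast_sub_one] at h
  have h0 := algebraMap_ne_zero (hτ n)
  have h1 := algebraMap_ne_zero (hτ (n + 1))
  have h2 := algebraMap_ne_zero (hF.slice_ne_zero n)
  have hB : PowerSeries.coeff j (optionEquivLeft ℕ+ ℂ (constT (τ n) * shiftHom (-1) (τ n) -
        X none * (constT (τ (n + 1)) * shiftHom (-1) (τ (n - 1))))) =
      τ n * PowerSeries.coeff j (shiftT (-1) (τ n)) -
        τ (n + 1) * PowerSeries.coeff j (PowerSeries.X * shiftT (-1) (τ (n - 1))) := by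
    rw [mul_left_comm (X none), map_sub (optionEquivLeft ℕ+ ℂ)]
    simp only [map_mul (optionEquivLeft ℕ+ ℂ), optionEquivLeft_constT, optionEquivLeft_shiftHom,
      optionEquivLeft_X_none, map_sub, PowerSeries.coeff_C_mul]
  rw [hB]
  apply IsFractionRing.injective OneTime TimeField
  simp only [map_mul, map_sub, map_pow]
  rw [shiftX] at h
  field_simp at h
  linear_combination h

/-- For `T₂`, `F_{n+1}(𝐭, -𝐭-[w]) τ_n(𝐭)² =
F_n(𝐭, -𝐭) (τ_{n+1}(𝐭) τ_{n+1}(𝐭+[w]) - w τ_n(𝐭) τ_{n+2}(𝐭+[w]))`. -/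
theorem psi₂_of_T₂ (hτ : ∀ n, τ n ≠ 0) (hS : IsWaveOperators τ Sp Sm)
    (hF : IsTodaTauOf F (miura₂ Sp Sm)) (n : ℤ) :
    sliceShift 0 (-1) (F (n + 1)) * constT (τ n ^ 2) =
      constT (slice (F n)) * (constT (τ (n + 1)) * shiftHom 1 (τ (n + 1)) -
        X none * (constT (τ n) * shiftHom 1 (τ (n + 2)))) := by
  refine eq_of_coeff fun j => ?_
  have h : todaPsi₂ F n (n + j) = -(((T₂ Sp).comp Sm.adjoint) (n + j - n) n) :=
    (congrFun (congrFun hF.psi₂ n) (n + j)).trans (DiffOp.act_zPow _ _ _)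
  rw [T₂_comp, hS.b₀_eq, hS.minus_coeff, hS.minus_coeff, todaPsi₂,
    show n + (j : ℤ) - n = j by ring, add_sub_cancel_right, show n + 1 + 1 = n + 2 by ring,
    zcoeff_natCast, zcoeff_natCast, zcoeff_natCast_sub_one] at h
  have h0 := algebraMap_ne_zero (hτ n)
  have h1 := algebraMap_ne_zero (hτ (n + 1))
  have h2 := algebraMap_ne_zero (hF.slice_ne_zero n)
  have hB : PowerSeries.coeff j (optionEquivLeft ℕ+ ℂ (constT (τ (n + 1)) *
        shiftHom 1 (τ (n + 1)) - X none * (constT (τ n) * shiftHom 1 (τ (n + 2))))) =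
      τ (n + 1) * PowerSeries.coeff j (shiftT 1 (τ (n + 1))) -
        τ n * PowerSeries.coeff j (PowerSeries.X * shiftT 1 (τ (n + 2))) := by
    rw [mul_left_comm (X none), map_sub (optionEquivLeft ℕ+ ℂ)]
    simp only [map_mul (optionEquivLeft ℕ+ ℂ), optionEquivLeft_constT, optionEquivLeft_shiftHom,
      optionEquivLeft_X_none, map_sub, PowerSeries.coeff_C_mul]
  rw [hB]
  apply IsFractionRing.injective OneTime TimeField
  simp only [map_mul, map_sub, map_pow]
  rw [shiftY] at h
  field_simp at h
  linear_combination h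

/-- The value at `w = 0`. -/
theorem eq_of_sliceShift_mul_eq {ε δ : ℂ} {F : TwoTime} {D G : OneTime} {B : SpecTime}
    (h : sliceShift ε δ F * constT D = constT G * B) :
    slice F * D = G * PowerSeries.constantCoeff (optionEquivLeft ℕ+ ℂ B) := by
  have h' := congrArg (fun P => PowerSeries.constantCoeff (optionEquivLeft ℕ+ ℂ P)) h
  simpa only [map_mul, optionEquivLeft_constT, constantCoeff_sliceShift,
    PowerSeries.constantCoeff_C] using h'

/-- If each `G_n / D_n` is a constant and these constants satisfy the recursion
`G_{n+1} / D_{n+1} = G_n / D_n`, then one constant serves all `n`. -/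
theorem exists_const_of_ratio {G D : ℤ → OneTime} (hG : ∀ n, G n ≠ 0)
    (h : ∀ n, ∃ c : ℂ, G n = C c * D n) (hGD : ∀ n, G (n + 1) * D n = G n * D (n + 1)) :
    ∃ c : ℂ, c ≠ 0 ∧ ∀ n, G n = C c * D n := by
  choose c hc using h
  have hD : ∀ n, D n ≠ 0 := fun n h0 => hG n (by rw [hc, h0, mul_zero])
  have hstep : ∀ n, c (n + 1) = c n := by
    intro n
    have h1 := hGD n
    rw [hc, hc n] at h1
    have h2 : (C (c (n + 1)) - C (c n) : OneTime) * (D n * D (n + 1)) = 0 := by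
      linear_combination h1
    have h3 := (mul_eq_zero.mp h2).resolve_right (mul_ne_zero (hD _) (hD _))
    exact MvPowerSeries.C_injective (sub_eq_zero.mp h3)
  have hconst : ∀ n, c n = c 0 := by
    intro n
    induction n using Int.induction_on with
    | zero => rfl
    | succ n ih => rw [hstep, ih]
    | pred n ih => rw [← ih, ← hstep, sub_add_cancel]
  refine ⟨c 0, fun h0 => hG 0 (by rw [hc, h0, map_zero, zero_mul]), fun n => ?_⟩
  rw [hc, hconst]

theorem slice_eq_of_T₁ (hτ : ∀ n, τ n ≠ 0) (hS : IsWaveOperators τ Sp Sm)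
    (hF : IsTodaTauOf F (miura₁ Sp Sm)) :
    ∃ c : ℂ, c ≠ 0 ∧ ∀ n, slice (F n) = C c * (τ n * τ (n - 1)) := by
  have hrec : ∀ n, slice (F (n + 1)) * τ (n - 1) = slice (F n) * τ (n + 1) := fun n => by
    simpa only [optionEquivLeft_shiftHom, constantCoeff_shiftT] using
      eq_of_sliceShift_mul_eq (psi₂_of_T₁ hτ hS hF n)
  refine exists_const_of_ratio hF.slice_ne_zero (fun n => ?_) fun n => ?_
  · obtain ⟨n, rfl⟩ : ∃ m, n = m + 1 := ⟨n - 1, by ring⟩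
    have hn : n + 1 - 1 = n := by ring
    have h₁ := psi₁_of_T₁ hτ hS hF (n + 1)
    have h₂ := psi₂_of_T₁ hτ hS hF n
    have hr := congrArg constT (hrec n)
    rw [hn] at h₁ ⊢
    rw [map_mul, map_mul] at hr
    have hB : translate (constT (τ n) * shiftHom 1 (τ (n + 1))) =
        shiftHom (-1) (τ n) * constT (τ (n + 1)) := by
      rw [map_mul, translate_constT, translate_shiftHom_one]
    refine exists_eq_C_mul_of_sliceShift (F := F (n + 1)) (mul_ne_zero (hτ _) (hτ _))
      (B := constT (τ n) * shiftHom 1 (τ (n + 1))) ?_ ?_ ?_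
    · rw [hB]
      exact mul_ne_zero (shiftHom_ne_zero _ (hτ _)) (constT_ne_zero (hτ _))
    · -- `hr` replaces `G_n` by `G_{n+1}`, as `G_{n+1} τ_{n-1} = G_n τ_{n+1}`.
      refine mul_right_cancel₀ (constT_ne_zero (hτ (n - 1))) ?_
      rw [map_mul]
      linear_combination constT (τ (n + 1)) * constT (τ n) * h₂ -
        constT (τ n) * shiftHom 1 (τ (n + 1)) * hr
    · rw [hB, map_mul]
      linear_combination constT (τ (n + 1)) * h₁
  · rw [show n + 1 - 1 = n by ring]
    linear_combination τ n * hrec n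

theorem slice_eq_of_T₂ (hτ : ∀ n, τ n ≠ 0) (hS : IsWaveOperators τ Sp Sm)
    (hF : IsTodaTauOf F (miura₂ Sp Sm)) :
    ∃ c : ℂ, c ≠ 0 ∧ ∀ n, slice (F n) = C c * τ n ^ 2 := by
  have hrec : ∀ n, slice (F (n + 1)) * τ n ^ 2 = slice (F n) * τ (n + 1) ^ 2 := fun n => by
    have h := eq_of_sliceShift_mul_eq (psi₂_of_T₂ hτ hS hF n)
    simp only [map_sub, map_mul, optionEquivLeft_constT, optionEquivLeft_shiftHom,
      optionEquivLeft_X_none, constantCoeff_shiftT, PowerSeries.constantCoeff_C,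
      PowerSeries.constantCoeff_X] at h
    linear_combination h
  refine exists_const_of_ratio hF.slice_ne_zero (fun n => ?_) hrec
  obtain ⟨n, rfl⟩ : ∃ m, n = m + 1 := ⟨n - 1, by ring⟩
  have h₁ := psi₁_of_T₂ hτ hS hF (n + 1)
  have h₂ := psi₂_of_T₂ hτ hS hF n
  have hr := congrArg constT (hrec n)
  rw [show n + 1 - 1 = n by ring, show n + 1 + 1 = n + 2 by ring] at h₁
  rw [map_mul, map_mul] at hr
  have hB : translate (constT (τ (n + 1)) * shiftHom 1 (τ (n + 1)) -
      X none * (constT (τ n) * shiftHom 1 (τ (n + 2)))) =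
      constT (τ (n + 1)) * shiftHom (-1) (τ (n + 1)) -
        X none * (constT (τ (n + 2)) * shiftHom (-1) (τ n)) := by
    simp only [map_sub, map_mul, translate_constT, translate_shiftHom_one, translate_X_none]
    ring
  refine exists_eq_C_mul_of_sliceShift (pow_ne_zero 2 (hτ _)) ?_ ?_ (hB ▸ h₁)
  · rw [hB]
    intro h0
    have h1 := congrArg (fun P => PowerSeries.constantCoeff (optionEquivLeft ℕ+ ℂ P)) h0
    simp only [map_sub, map_mul, optionEquivLeft_constT, optionEquivLeft_shiftHom,
      optionEquivLeft_X_none, constantCoeff_shiftT, PowerSeries.constantCoeff_C,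
      PowerSeries.constantCoeff_X, zero_mul, sub_zero, map_zero] at h1
    exact mul_ne_zero (hτ _) (hτ _) h1
  · -- `hr` replaces `G_n` by `G_{n+1}`, as `G_{n+1} τ_n² = G_n τ_{n+1}²`.
    refine mul_right_cancel₀ (constT_ne_zero (pow_ne_zero 2 (hτ n))) ?_
    linear_combination constT (τ (n + 1) ^ 2) * h₂ - (constT (τ (n + 1)) *
      shiftHom 1 (τ (n + 1)) - X none * (constT (τ n) * shiftHom 1 (τ (n + 2)))) * hr

end Wave

end LargeBKP

theorem mainTheorem7 (τ : ℤ → LargeBKP.OneTime) (hτ : LargeBKP.IsLargeBKPTau τ)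
    (Sp Sm : LargeBKP.DiffOp) (hS : LargeBKP.IsWaveOperators τ Sp Sm)
    (F : ℤ → LargeBKP.TwoTime) :
    (LargeBKP.IsTodaTauOf F (LargeBKP.miura₁ Sp Sm) →
      ∃ c : ℂ, c ≠ 0 ∧ ∀ n : ℤ,
        LargeBKP.slice (F n) = MvPowerSeries.C c * (τ n * τ (n - 1))) ∧
    (LargeBKP.IsTodaTauOf F (LargeBKP.miura₂ Sp Sm) →
      ∃ c : ℂ, c ≠ 0 ∧ ∀ n : ℤ,
        LargeBKP.slice (F n) = MvPowerSeries.C c * τ n ^ 2) :=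
  ⟨LargeBKP.slice_eq_of_T₁ hτ.ne_zero hS, LargeBKP.slice_eq_of_T₂ hτ.ne_zero hS⟩
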